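/- **Random tensor networks.** Let $a\ge 1$, $n\ge 0$. Consider a finite connected graph $G=(V,E_{\rm int})$ (without loops; parallel edges are represented by a single edge carrying the product of their dimensions) with $n$ additional external edges (physical sites), each attached to one vertex. Every physical site has dimension $a$, every internal edge $e$ has a bond dimension $b_e\ge 1$, and every vertex $i$ has a logical (bulk) leg of dimension $d_i\ge 1$ (a leg of dimension $1$ is the same as no leg). If $n_i$ external edges are attached to the vertex $i$, put $\mathcal H_i=(\mathbb C^a)^{\otimes n_i}\otimes\mathbb C^{d_i}\otimes\bigotimes_{j\sim i}\mathbb C^{b_{\langle i,j\rangle}}$ and $|\psi_i\rangle=U_i|0\rangle_i$, where $|0\rangle_i\in\mathcal H_i$ is an arbitrary unit vector and the $U_i$ are independent Haar-random unitaries on $\mathcal H_i$. For a bulk vector $\Phi\in\bigotimes_i\mathbb C^{d_i}$ the random tensor network (RTN) state is $$|\psi\rangle=\langle\Phi|\bigotimes_{\langle j,k\rangle\in E_{\rm int}}\langle j\,k|\bigotimes_{i\in V}|\psi_i\rangle\in(\mathbb C^a)^{\otimes n},\qquad |j\,k\rangle=\sum_{x=1}^{b_{\langle j,k\rangle}}|x\rangle|x\rangle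 .$$ For a reference vector $\phi\in(\mathbb C^a)^{\otimes n}$ the effective dimension $D_{\rm eff}$ is defined by $$\frac1{D_{\rm eff}}=a^n\,\frac{\mathbb E\big[|\langle\psi|\phi\rangle|^4\big]}{\big(\mathbb E[\langle\psi|\psi\rangle]\big)^2}.$$ **Corollary (Bound on effective dimension).** Let $\Phi$ and $\phi$ be unentangled (product) unit vectors. Then every RTN on $n$ physical sites satisfies $$\frac1{D_{\rm eff}}\ \ge\ \frac{2}{a^n+1},\qquad\text{and consequently}\qquad D_{\rm eff}\le\frac{a^n+1}{2}.$$ Both bounds are attained, for all $a\ge1$ and $n\ge 0$, by a single random tensor with $n$ physical legs and no bulk leg (one vertex, no internal edges, $d=1$). -/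

import Mathlib

open MeasureTheory Matrix

noncomputable section

namespace RandomTensorNetwork

/-! ### The Haar probability measure on the unitary group -/

/-- The unitary group of a finite index type is compact. -/
instance compactSpace_unitaryGroup (ι : Type*) [Fintype ι] [DecidableEq ι] :
    CompactSpace (Matrix.unitaryGroup ι ℂ) := by
  have hclosed : IsClosed ((Matrix.unitaryGroup ι ℂ : Submonoid (Matrix ι ι ℂ)) :
      Set (Matrix ι ι ℂ)) := isClosed_unitary
  have hbox : IsCompact (Set.univ.pi fun _ : ι => Set.univ.pi fun _ : ι =>
      Metric.closedBall (0 : ℂ) 1) :=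
    isCompact_univ_pi fun _ => isCompact_univ_pi fun _ => isCompact_closedBall _ _
  have hsub : ((Matrix.unitaryGroup ι ℂ : Submonoid (Matrix ι ι ℂ)) : Set (Matrix ι ι ℂ)) ⊆
      (Set.univ.pi fun _ : ι => Set.univ.pi fun _ : ι => Metric.closedBall (0 : ℂ) 1) := by
    intro U hU i _ j _
    simpa using entry_norm_bound_of_unitary hU i j
  exact isCompact_iff_compactSpace.mp (hbox.of_isClosed_subset hclosed hsub)

instance measurableSpace_unitaryGroup (ι : Type*) [Fintype ι] [DecidableEq ι] :
    MeasurableSpace (Matrix.unitaryGroup ι ℂ) :=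
  borel _

instance borelSpace_unitaryGroup (ι : Type*) [Fintype ι] [DecidableEq ι] :
    BorelSpace (Matrix.unitaryGroup ι ℂ) :=
  ⟨rfl⟩

/-- The normalized Haar measure on the unitary group (total mass `1`). -/
def haarUnitary (ι : Type*) [Fintype ι] [DecidableEq ι] : Measure (Matrix.unitaryGroup ι ℂ) :=
  Measure.haarMeasure ⊤

instance isProbabilityMeasure_haarUnitary (ι : Type*) [Fintype ι] [DecidableEq ι] :
    IsProbabilityMeasure (haarUnitary ι) :=
  ⟨by simpa [haarUnitary] using
    Measure.haarMeasure_self (K₀ := (⊤ : TopologicalSpace.PositiveCompacts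
      (Matrix.unitaryGroup ι ℂ)))⟩

/-! ### Tensor networks -/

/-- The geometry of a tensor network with `n` physical sites of dimension `a`: a connected
graph of tensors, the vertex to which each of the `n` external edges is attached, the bond
dimension of every internal edge and the dimension of the logical leg at every vertex. A logical
or internal leg of dimension `1` is the same as no leg. Parallel internal edges are represented
by one edge that carries the product of their dimensions. -/
structure Network (V : Type*) (a n : ℕ) where
  graph : SimpleGraph V
  connected : graph.Connected
  /-- the vertex to which the external edge of each physical site is attached -/
  site : Fin n → V
  bondDim : graph.edgeSet → ℕ
  bondDim_pos : ∀ e, 1 ≤ bondDim e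
  logDim : V → ℕ
  logDim_pos : ∀ k, 1 ≤ logDim k

namespace Network

variable {V : Type*} {a n : ℕ}

/-- The internal edge between `i` and a vertex adjacent to it. -/
def edgeTo (N : Network V a n) (i : V) (j : N.graph.neighborSet i) : N.graph.edgeSet :=
  ⟨s(i, j), j.2⟩

/-- The index set of the tensor at `i`: a physical index for each site attached to `i`, a logical
index, and a bond index for each vertex adjacent to `i`. The Hilbert space of the tensor,
`(ℂ^a)^{⊗ (number of sites at i)} ⊗ ℂ^{d_i} ⊗ ⨂_j ℂ^{b_{ij}}`, is
`EuclideanSpace ℂ (N.TensorIdx i)`. -/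
abbrev TensorIdx (N : Network V a n) (i : V) : Type _ :=
  ({x : Fin n // N.site x = i} → Fin a) × Fin (N.logDim i) ×
    ((j : N.graph.neighborSet i) → Fin (N.bondDim (N.edgeTo i j)))

/-- The bulk Hilbert space `⨂_k ℂ^{d_k}`. -/
abbrev BulkSpace (N : Network V a n) : Type _ :=
  EuclideanSpace ℂ ((k : V) → Fin (N.logDim k))

open Classical in
instance fintypeTensorIdx [Fintype V] (N : Network V a n) (i : V) : Fintype (N.TensorIdx i) :=
  inferInstance

open Classical in
instance decidableEqTensorIdx [Fintype V] (N : Network V a n) (i : V) :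
    DecidableEq (N.TensorIdx i) :=
  inferInstance

end Network

/-- The physical Hilbert space `(ℂ^a)^{⊗ n}`. -/
abbrev PhysSpace (a n : ℕ) : Type := EuclideanSpace ℂ (Fin n → Fin a)

/-- A vector of a tensor product `⨂_k ℂ^{d_k}` is unentangled if it is a product vector. -/
def IsUnentangled {K : Type*} [Fintype K] {d : K → ℕ}
    (v : EuclideanSpace ℂ ((k : K) → Fin (d k))) : Prop :=
  ∃ f : (k : K) → EuclideanSpace ℂ (Fin (d k)), ∀ c, v c = ∏ k, f k (c k)

namespace Network

variable {V : Type*} [Fintype V] [DecidableEq V] {a n : ℕ}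

open Classical in
/-- The tensor network state `⟨Φ| ⨂_{⟨j,k⟩} ⟨j k| ⨂_i |ψ_i⟩` with `|j k⟩ = ∑_x |x⟩|x⟩` on every
internal edge: contraction with `|j k⟩` sets the two indices at the ends of the edge equal and
sums over their common value `β e`. -/
def state (N : Network V a n) (Φ : N.BulkSpace)
    (T : (i : V) → EuclideanSpace ℂ (N.TensorIdx i)) : PhysSpace a n :=
  WithLp.toLp 2 fun s =>
    ∑ c : (k : V) → Fin (N.logDim k), ∑ β : (e : N.graph.edgeSet) → Fin (N.bondDim e),
      star (Φ c) * ∏ i, T i (fun x => s x, c i, fun j => β (N.edgeTo i j))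

/-- The random tensor `U |0⟩` at the vertex `i`. -/
def tensor (N : Network V a n) (i : V) (ref : EuclideanSpace ℂ (N.TensorIdx i))
    (U : Matrix.unitaryGroup (N.TensorIdx i) ℂ) : EuclideanSpace ℂ (N.TensorIdx i) :=
  WithLp.toLp 2 ((U : Matrix (N.TensorIdx i) (N.TensorIdx i) ℂ) *ᵥ ref.ofLp)

/-- The random tensor network state, as a function of the unitaries. -/
def randomState (N : Network V a n) (Φ : N.BulkSpace)
    (ref : (i : V) → EuclideanSpace ℂ (N.TensorIdx i))
    (U : (i : V) → Matrix.unitaryGroup (N.TensorIdx i) ℂ) : PhysSpace a n :=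
  N.state Φ fun i => N.tensor i (ref i) (U i)

/-- The joint law of the unitaries: independent and Haar distributed. -/
def law (N : Network V a n) : Measure ((i : V) → Matrix.unitaryGroup (N.TensorIdx i) ℂ) :=
  Measure.pi fun i => haarUnitary (N.TensorIdx i)

/-- The inverse effective dimension `1 / D_eff = a^n 𝔼[|⟨ψ|φ⟩|^4] / (𝔼[⟨ψ|ψ⟩])^2`. -/
def invEffDim (N : Network V a n) (ref : (i : V) → EuclideanSpace ℂ (N.TensorIdx i))
    (Φ : N.BulkSpace) (φ : PhysSpace a n) : ℝ :=
  (a : ℝ) ^ n * (∫ U, ‖inner ℂ (N.randomState Φ ref U) φ‖ ^ 4 ∂N.law) /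
    (∫ U, ‖N.randomState Φ ref U‖ ^ 2 ∂N.law) ^ 2

/-- The effective dimension `D_eff`. -/
def effDim (N : Network V a n) (ref : (i : V) → EuclideanSpace ℂ (N.TensorIdx i))
    (Φ : N.BulkSpace) (φ : PhysSpace a n) : ℝ :=
  (N.invEffDim ref Φ φ)⁻¹

end Network

/-- The network that consists of a single tensor with `n` physical legs and no bulk leg. -/
def singleTensor (a n : ℕ) : Network Unit a n where
  graph := ⊥
  connected := SimpleGraph.Connected.mk fun _ _ => SimpleGraph.Reachable.refl _
  site := fun _ => ()
  bondDim := fun _ => 1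
  bondDim_pos := fun _ => le_rfl
  logDim := fun _ => 1
  logDim_pos := fun _ => le_rfl

end RandomTensorNetwork

end

/-! A Haar random unit vector in dimension `D` has fourth moments equal to `1 / (D (D + 1))` times
the sum of the two ways of pairing the unconjugated with the conjugated indices (`fourthMoment_eq`).
Expanding the network and choosing a pairing at each vertex gives a sum over spins `σ : V → Bool`
whose terms factorize over legs (`integral_contraction_fourth_eq_sum_spins`). Product vectors
contribute only their norms. A bond of dimension `b` contributes `b ^ 2` if its end spins agree and
`b` otherwise. After normalization, `1 / D_eff` is `a ^ (-n) * ∏ (1 + 1 / D_i)⁻¹ * Z`, with `Z` an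
Ising partition function of weight `1 / b` per cut edge (`invEffDim_eq`).

It remains to see that `2 * ∏ (1 + 1 / D_i) ≤ (1 + a ^ (-n)) * Z` (`two_mul_prod_le_spin_sum`).
Write `1 / D_i` as `x_i`, from the physical and logical legs, times the inverse bond dimensions at
`i`. Expanding the product gives a sum over up-sets of spins, and each term is at most `X σ * z σ`,
where `X σ` is the product of `x_i` over up spins and `z σ` is the Ising weight. Averaging over the
global spin flip and using `(1 - X) * (1 - X') ≥ 0` gives the factor `1 + ∏ x_i ≤ 1 + a ^ (-n)`. -/

noncomputable section

namespace RandomTensorNetwork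

open scoped ComplexConjugate

/-! ### Second and fourth moments of a Haar random vector -/

section HaarMoments

variable {ι : Type*} [Fintype ι] [DecidableEq ι]

instance isMulLeftInvariant_haarUnitary : (haarUnitary ι).IsMulLeftInvariant := by
  unfold haarUnitary; infer_instance

/-- The orbit of a vector `r` under the unitary group, in coordinates. -/
def haarVec (r : ι → ℂ) (U : Matrix.unitaryGroup ι ℂ) : ι → ℂ :=
  (U : Matrix ι ι ℂ) *ᵥ r


lemma continuous_haarVec (r : ι → ℂ) (x : ι) : Continuous fun U => haarVec r U x := by
  unfold haarVec
  exact (continuous_apply x).comp (continuous_subtype_val.matrix_mulVec continuous_const)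

lemma integrable_of_continuous {f : Matrix.unitaryGroup ι ℂ → ℂ} (hf : Continuous f) :
    Integrable f (haarUnitary ι) :=
  hf.integrable_of_hasCompactSupport (HasCompactSupport.of_compactSpace f)

lemma integral_haarVec_mulVec (r : ι → ℂ) (F : (ι → ℂ) → ℂ) (W : Matrix.unitaryGroup ι ℂ) :
    ∫ U, F ((W : Matrix ι ι ℂ) *ᵥ haarVec r U) ∂haarUnitary ι
      = ∫ U, F (haarVec r U) ∂haarUnitary ι := by
  rw [← integral_mul_left_eq_self (μ := haarUnitary ι) (fun U => F (haarVec r U)) W]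
  simp [haarVec, mulVec_mulVec]

lemma sum_haarVec_mul_conj (r : ι → ℂ) (hr : star r ⬝ᵥ r = 1) (U : Matrix.unitaryGroup ι ℂ) :
    ∑ x, haarVec r U x * conj (haarVec r U x) = 1 := by
  have h : star (haarVec r U) ⬝ᵥ haarVec r U = 1 := by
    unfold haarVec
    rw [star_mulVec, dotProduct_mulVec, vecMul_vecMul, ← star_eq_conjTranspose,
      Unitary.coe_star_mul_self, vecMul_one, hr]
  rw [← h]
  simp [dotProduct, mul_comm]

/-- The fourth moments of a Haar random vector. -/
def fourthMoment (r : ι → ℂ) (x x' y y' : ι) : ℂ :=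
  ∫ U, haarVec r U x * haarVec r U x' * conj (haarVec r U y) * conj (haarVec r U y')
    ∂haarUnitary ι

/-- The diagonal unitary with phase `i` at `z`. -/
def phaseUnitary (z : ι) : Matrix.unitaryGroup ι ℂ :=
  ⟨diagonal fun k => if k = z then Complex.I else 1, by
    rw [mem_unitaryGroup_iff, star_eq_conjTranspose, diagonal_conjTranspose, diagonal_mul_diagonal,
      ← diagonal_one]
    congr 1
    funext k
    by_cases h : k = z <;> simp [h]⟩

lemma fourthMoment_eq_phase_mul (r : ι → ℂ) (x x' y y' z : ι) :
    fourthMoment r x x' y y' =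
      (if x = z then Complex.I else 1) * (if x' = z then Complex.I else 1) *
        (if y = z then -Complex.I else 1) * (if y' = z then -Complex.I else 1) *
          fourthMoment r x x' y y' := by
  conv_lhs => rw [fourthMoment,
    ← integral_haarVec_mulVec r (fun u => u x * u x' * conj (u y) * conj (u y')) (phaseUnitary z)]
  rw [fourthMoment, ← integral_const_mul]
  refine integral_congr_ae (.of_forall fun U => ?_)
  have h (k : ι) : conj (if k = z then Complex.I else 1) = if k = z then -Complex.I else 1 := by
    split_ifs <;> simp
  simp only [phaseUnitary, mulVec_diagonal, map_mul, h]
  ring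

/-- Unless the indices pair up, some coordinate phase multiplies the moment by `I` or `-1`. The
phase is put at `x'` if `x` matches one of `y`, `y'`, and at `x` otherwise. -/
lemma fourthMoment_eq_zero (r : ι → ℂ) {x x' y y' : ι}
    (h₁ : ¬ (x = y ∧ x' = y')) (h₂ : ¬ (x = y' ∧ x' = y)) :
    fourthMoment r x x' y y' = 0 := by
  have key (c : ℂ) (hc : c ≠ 1)
      (h : fourthMoment r x x' y y' = c * fourthMoment r x x' y y') :
      fourthMoment r x x' y y' = 0 := by
    have : (1 - c) * fourthMoment r x x' y y' = 0 := by linear_combination h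
    exact (mul_eq_zero.mp this).resolve_left (sub_ne_zero.mpr hc.symm)
  have hI : Complex.I ≠ 1 := fun h => by simpa using congrArg Complex.re h
  have hI' : (-1 : ℂ) ≠ 1 := by norm_num
  by_cases hy : x = y
  · subst hy
    have h3 : x' ≠ y' := fun h => h₁ ⟨rfl, h⟩
    refine key _ ?_ (fourthMoment_eq_phase_mul r x x' x y' x')
    by_cases h : x = x' <;> simp [h, h3.symm, hI]
  · by_cases hy' : x = y'
    · subst hy'
      have h3 : x' ≠ y := fun h => h₂ ⟨rfl, h⟩
      refine key _ ?_ (fourthMoment_eq_phase_mul r x x' y x x')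
      by_cases h : x = x' <;> simp [h, h3.symm, hI]
    · refine key _ ?_ (fourthMoment_eq_phase_mul r x x' y y' x)
      by_cases h : x' = x <;> simp [h, Ne.symm hy, Ne.symm hy', hI, hI']

lemma fourthMoment_swap_left (r : ι → ℂ) (x x' y y' : ι) :
    fourthMoment r x x' y y' = fourthMoment r x' x y y' := by
  simp only [fourthMoment, mul_comm (haarVec r _ x)]

lemma fourthMoment_swap_right (r : ι → ℂ) (x x' y y' : ι) :
    fourthMoment r x x' y y' = fourthMoment r x x' y' y := by
  simp only [fourthMoment, mul_right_comm _ (conj (haarVec r _ y))]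

/-- A unitary square root of the transposition of the basis vectors `x` and `y`. -/
def sqrtSwap (x y : ι) (h : x ≠ y) : Matrix.unitaryGroup ι ℂ :=
  -- The vector `e_x - e_y` has squared norm 2, so it is an eigenvector with eigenvalue `I`; its
  -- orthogonal complement is fixed.
  ⟨1 - ((1 - Complex.I) / 2) •
      vecMulVec (Pi.single x 1 - Pi.single y 1 : ι → ℂ) (Pi.single x 1 - Pi.single y 1), by
    have hw : star (Pi.single x 1 - Pi.single y 1 : ι → ℂ) = Pi.single x 1 - Pi.single y 1 := by
      simp
    have hd : (Pi.single x 1 - Pi.single y 1 : ι → ℂ) ⬝ᵥ (Pi.single x 1 - Pi.single y 1) = 2 := by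
      simp [h, h.symm]; norm_num
    generalize (Pi.single x 1 - Pi.single y 1 : ι → ℂ) = w at hw hd
    rw [mem_unitaryGroup_iff, star_eq_conjTranspose, conjTranspose_sub, conjTranspose_smul,
      conjTranspose_vecMulVec, hw, conjTranspose_one, sub_mul, one_mul, mul_sub, mul_one,
      smul_mul_smul_comm, vecMulVec_mul_vecMulVec, hd, vecMulVec_smul, smul_smul, sub_sub,
      ← sub_eq_zero]
    have hI : star ((1 - Complex.I) / 2) = (1 + Complex.I) / 2 := by
      simp
    rw [hI]
    -- With `c = (1 - I) / 2`, unitarity amounts to `2 * |c| ^ 2 = c + conj c`.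
    have : (1 - Complex.I) / 2 * ((1 + Complex.I) / 2) * 2 =
      (1 - Complex.I) / 2 + (1 + Complex.I) / 2 := by
      linear_combination (-1/2) * Complex.I_sq
    rw [this]
    module⟩

lemma sqrtSwap_mulVec_left (x y : ι) (h : x ≠ y) (u : ι → ℂ) :
    ((sqrtSwap x y h : Matrix ι ι ℂ) *ᵥ u) x
      = (1 + Complex.I) / 2 * u x + (1 - Complex.I) / 2 * u y := by
  simp [sqrtSwap, sub_mulVec, smul_mulVec, vecMulVec_mulVec, h, sub_dotProduct]
  ring

lemma sqrtSwap_mulVec_right (x y : ι) (h : x ≠ y) (u : ι → ℂ) :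
    ((sqrtSwap x y h : Matrix ι ι ℂ) *ᵥ u) y
      = (1 - Complex.I) / 2 * u x + (1 + Complex.I) / 2 * u y := by
  simp [sqrtSwap, sub_mulVec, smul_mulVec, vecMulVec_mulVec, h.symm, sub_dotProduct]
  ring

lemma integral_linear_comb_fourth (r : ι → ℂ) {κ : Type*} [Fintype κ] (α : κ → ℂ) (z : κ → ι) :
    ∫ U, (∑ k, α k * haarVec r U (z k)) * (∑ k, α k * haarVec r U (z k)) *
        conj (∑ k, α k * haarVec r U (z k)) * conj (∑ k, α k * haarVec r U (z k))
        ∂haarUnitary ι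
      = ∑ k, ∑ l, ∑ p, ∑ q, α k * α l * conj (α p) * conj (α q) *
          fourthMoment r (z k) (z l) (z p) (z q) := by
  have hc := continuous_haarVec r
  simp only [fourthMoment, ← integral_const_mul]
  have hi (k l p q : κ) : Integrable (fun U => α k * α l * conj (α p) * conj (α q) *
      (haarVec r U (z k) * haarVec r U (z l) * conj (haarVec r U (z p)) *
        conj (haarVec r U (z q)))) (haarUnitary ι) :=
    integrable_of_continuous (by fun_prop)
  have hs (U : Matrix.unitaryGroup ι ℂ) : (∑ k, α k * haarVec r U (z k)) *
      (∑ k, α k * haarVec r U (z k)) * conj (∑ k, α k * haarVec r U (z k)) *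
      conj (∑ k, α k * haarVec r U (z k)) =
      ∑ k, ∑ l, ∑ p, ∑ q, α k * α l * conj (α p) * conj (α q) *
      (haarVec r U (z k) * haarVec r U (z l) * conj (haarVec r U (z p)) *
        conj (haarVec r U (z q))) := by
    calc _ = ∑ k, ∑ l, ∑ p, ∑ q, (α k * haarVec r U (z k)) * (α l * haarVec r U (z l)) *
          conj (α p * haarVec r U (z p)) * conj (α q * haarVec r U (z q)) := by
          simp_rw [← Finset.mul_sum, ← Finset.sum_mul, ← Finset.mul_sum, ← Finset.sum_mul, map_sum]
          rw [Finset.sum_mul_sum]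
      _ = _ := by
          refine Finset.sum_congr rfl fun _ _ => Finset.sum_congr rfl fun _ _ =>
            Finset.sum_congr rfl fun _ _ => Finset.sum_congr rfl fun _ _ => ?_
          simp only [map_mul]
          ring
  simp_rw [hs]
  rw [integral_finsetSum _ fun _ _ => integrable_finsetSum _ fun _ _ =>
    integrable_finsetSum _ fun _ _ => integrable_finsetSum _ fun _ _ => hi _ _ _ _]
  refine Finset.sum_congr rfl fun _ _ => ?_
  rw [integral_finsetSum _ fun _ _ => integrable_finsetSum _ fun _ _ =>
    integrable_finsetSum _ fun _ _ => hi _ _ _ _]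
  refine Finset.sum_congr rfl fun _ _ => ?_
  rw [integral_finsetSum _ fun _ _ => integrable_finsetSum _ fun _ _ => hi _ _ _ _]
  refine Finset.sum_congr rfl fun _ _ => ?_
  rw [integral_finsetSum _ fun _ _ => hi _ _ _ _]

/-- Of the sixteen terms, ten are unpaired and vanish; the four mixed ones that survive coincide by
symmetry. -/
lemma integral_two_term_fourth (r : ι → ℂ) {x y : ι} (h : x ≠ y) (α β : ℂ) :
    ∫ U, (α * haarVec r U x + β * haarVec r U y) * (α * haarVec r U x + β * haarVec r U y) *
        conj (α * haarVec r U x + β * haarVec r U y) *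
        conj (α * haarVec r U x + β * haarVec r U y) ∂haarUnitary ι
      = (α * conj α) ^ 2 * fourthMoment r x x x x + (β * conj β) ^ 2 * fourthMoment r y y y y
        + 4 * (α * conj α) * (β * conj β) * fourthMoment r x y x y := by
  have := integral_linear_comb_fourth r (fun b : Bool => if b then α else β)
    (fun b => if b then x else y)
  simp only [Fintype.sum_bool, if_true, Bool.false_eq_true, if_false] at this
  rw [this]
  have h0 {p q s t : ι} (h₁ : ¬ (p = s ∧ q = t)) (h₂ : ¬ (p = t ∧ q = s)) :=
    fourthMoment_eq_zero r h₁ h₂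
  have h' := h.symm
  rw [h0 (p := x) (q := x) (s := x) (t := y), h0 (p := x) (q := x) (s := y) (t := x),
    h0 (p := x) (q := x) (s := y) (t := y), h0 (p := x) (q := y) (s := x) (t := x),
    h0 (p := x) (q := y) (s := y) (t := y), h0 (p := y) (q := x) (s := x) (t := x),
    h0 (p := y) (q := x) (s := y) (t := y), h0 (p := y) (q := y) (s := x) (t := x),
    h0 (p := y) (q := y) (s := x) (t := y), h0 (p := y) (q := y) (s := y) (t := x),
    fourthMoment_swap_right r x y y x, fourthMoment_swap_left r y x x y,
    fourthMoment_swap_left r y x y x, fourthMoment_swap_right r x y y x]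
  · ring
  all_goals simp [h, h']

/-- Invariance under `sqrtSwap` makes both diagonal moments equal to a quarter of their sum plus the
mixed moment. -/
lemma fourthMoment_self_eq (r : ι → ℂ) {x y : ι} (h : x ≠ y) :
    fourthMoment r x x x x = 2 * fourthMoment r x y x y ∧
      fourthMoment r x x x x = fourthMoment r y y y y := by
  have hp : (1 + Complex.I) / 2 * conj ((1 + Complex.I) / 2) = 1 / 2 := by
    rw [map_div₀, map_add, map_one, Complex.conj_I, map_ofNat]
    linear_combination (-1 / 4) * Complex.I_sq
  have hm : (1 - Complex.I) / 2 * conj ((1 - Complex.I) / 2) = 1 / 2 := by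
    rw [map_div₀, map_sub, map_one, Complex.conj_I, map_ofNat]
    linear_combination (-1 / 4) * Complex.I_sq
  have h1 := integral_haarVec_mulVec r (fun u => u x * u x * conj (u x) * conj (u x))
    (sqrtSwap x y h)
  have h2 := integral_haarVec_mulVec r (fun u => u y * u y * conj (u y) * conj (u y))
    (sqrtSwap x y h)
  simp only [sqrtSwap_mulVec_left, sqrtSwap_mulVec_right] at h1 h2
  rw [integral_two_term_fourth r h, hp, hm] at h1
  rw [integral_two_term_fourth r h, hp, hm] at h2
  rw [← fourthMoment] at h1 h2
  constructor
  · linear_combination -3/2 * h1 - 1/2 * h2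
  · linear_combination h2 - h1

lemma sum_fourthMoment (r : ι → ℂ) (hr : star r ⬝ᵥ r = 1) (x y : ι) :
    ∑ x', fourthMoment r x x' y x' =
      ∫ U, haarVec r U x * conj (haarVec r U y) ∂haarUnitary ι := by
  have hc := continuous_haarVec r
  simp only [fourthMoment]
  rw [← integral_finsetSum _ fun _ _ => integrable_of_continuous (by fun_prop)]
  refine integral_congr_ae (.of_forall fun U => ?_)
  have := sum_haarVec_mul_conj r hr U
  calc _ = (haarVec r U x * conj (haarVec r U y)) *
        ∑ x', haarVec r U x' * conj (haarVec r U x') := by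
        rw [Finset.mul_sum]; exact Finset.sum_congr rfl fun _ _ => by ring
    _ = _ := by rw [this, mul_one]

/-- The fourth moments of a Haar random unit vector. -/
theorem fourthMoment_eq (r : ι → ℂ) (hr : star r ⬝ᵥ r = 1) (x x' y y' : ι) :
    fourthMoment r x x' y y' = ((Fintype.card ι : ℂ) * (Fintype.card ι + 1))⁻¹ *
      ((if x = y ∧ x' = y' then 1 else 0) + (if x = y' ∧ x' = y then 1 else 0)) := by
  have hval (k l : ι) : fourthMoment r k l k l =
      fourthMoment r x x x x / 2 * (1 + if k = l then 1 else 0) := by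
    have hk (k : ι) : fourthMoment r k k k k = fourthMoment r x x x x := by
      by_cases h : k = x
      · rw [h]
      · exact (fourthMoment_self_eq r h).2
    by_cases h : k = l
    · subst h; rw [hk]; simp; ring
    · have := (fourthMoment_self_eq r h).1
      rw [hk] at this
      simp [this, h]
  have hsum : ∑ k, ∑ l, fourthMoment r k l k l = 1 := by
    have hc := continuous_haarVec r
    simp_rw [sum_fourthMoment r hr]
    rw [← integral_finsetSum _ fun _ _ => integrable_of_continuous (by fun_prop)]
    simp_rw [sum_haarVec_mul_conj r hr]
    simp
  -- Normalization fixes the remaining constant: the sum in `hsum` has `D ^ 2` generic contributions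
  -- and `D` extra diagonal ones.
  have hp : fourthMoment r x x x x / 2 = ((Fintype.card ι : ℂ) * (Fintype.card ι + 1))⁻¹ := by
    rw [Finset.sum_congr rfl fun k _ => Finset.sum_congr rfl fun l _ => hval k l] at hsum
    simp_rw [← Finset.mul_sum, Finset.sum_add_distrib] at hsum
    simp at hsum
    apply eq_inv_of_mul_eq_one_left
    linear_combination hsum
  rw [← hp]
  by_cases h₁ : x = y ∧ x' = y'
  · obtain ⟨rfl, rfl⟩ := h₁
    rw [hval]
    by_cases h : x = x' <;> simp [h]
  · by_cases h₂ : x = y' ∧ x' = y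
    · obtain ⟨rfl, rfl⟩ := h₂
      rw [fourthMoment_swap_right, hval]
      by_cases h : x = x'
      · subst h; simp at h₁
      · simp [h]
    · rw [fourthMoment_eq_zero r h₁ h₂]
      simp [h₁, h₂]

/-- The second moments of a Haar random unit vector. -/
theorem secondMoment_eq (r : ι → ℂ) (hr : star r ⬝ᵥ r = 1) (x y : ι) :
    ∫ U, haarVec r U x * conj (haarVec r U y) ∂haarUnitary ι =
      (Fintype.card ι : ℂ)⁻¹ * (if x = y then 1 else 0) := by
  have : Nonempty ι := ⟨x⟩
  -- The second moment is a partial trace of the fourth, giving `(D + 1) / (D (D + 1))` on the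
  -- diagonal.
  rw [← sum_fourthMoment r hr]
  simp_rw [fourthMoment_eq r hr]
  have h1 : (Fintype.card ι : ℂ) ≠ 0 := by exact_mod_cast Fintype.card_ne_zero
  have h2 : (Fintype.card ι : ℂ) + 1 ≠ 0 := by exact Nat.cast_add_one_ne_zero _
  have h3 : ∀ x', (x = x' ∧ x' = y) ↔ (x = x' ∧ x = y) := by
    intro x'; constructor <;> rintro ⟨rfl, rfl⟩ <;> simp
  simp_rw [h3, ← Finset.mul_sum, Finset.sum_add_distrib]
  by_cases h : x = y
  · simp [h]
    field_simp
  · simp [h]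

end HaarMoments

/-- The two ways to pair the arguments of a fourth moment. -/
def Paired {α : Type*} : Bool → α → α → α → α → Prop
  | true, x, x', y, y' => x = y ∧ x' = y'
  | false, x, x', y, y' => x = y' ∧ x' = y

open Classical in
/-- The indicator of a proposition. -/
def indicator (P : Prop) : ℂ := if P then 1 else 0

lemma prod_indicator {α : Type*} [Fintype α] (P : α → Prop) :
    ∏ a, indicator (P a) = indicator (∀ a, P a) := by
  simp only [indicator, Fintype.prod_ite_zero, Finset.prod_const_one]
  congr

lemma indicator_of {P : Prop} (h : P) : indicator P = 1 := if_pos h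

lemma indicator_of_not {P : Prop} (h : ¬ P) : indicator P = 0 := if_neg h

/-! ### Moments of contractions of independent random tensors -/

section Contraction

variable {V L Γ : Type*} [Fintype V] [Fintype L] [DecidableEq L] [Fintype Γ]
  {κ : V → Type*} [∀ i, Fintype (κ i)] [∀ i, DecidableEq (κ i)]

/-- The contraction of random tensors with indices labelled by the configurations `Γ`. -/
def contraction (idx : ∀ i, Γ → κ i) (r : ∀ i, κ i → ℂ) (C : Γ → ℂ)
    (U : ∀ i, Matrix.unitaryGroup (κ i) ℂ) : ℂ :=
  ∑ γ, C γ * ∏ i, haarVec (r i) (U i) (idx i γ)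

lemma integral_contraction_sq (idx : ∀ i, Γ → κ i) (r : ∀ i, κ i → ℂ) (C : Γ → ℂ) :
    Integrable (fun U => contraction idx r C U * conj (contraction idx r C U))
      (Measure.pi fun i => haarUnitary (κ i)) ∧
    ∫ U, contraction idx r C U * conj (contraction idx r C U)
        ∂(Measure.pi fun i => haarUnitary (κ i)) =
      ∑ γ₁, ∑ γ₂, C γ₁ * conj (C γ₂) * ∏ i,
        ∫ U, haarVec (r i) U (idx i γ₁) * conj (haarVec (r i) U (idx i γ₂)) ∂haarUnitary (κ i) := by
  have hc (i : V) := continuous_haarVec (r i)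
  have hexp (U : ∀ i, Matrix.unitaryGroup (κ i) ℂ) :
      contraction idx r C U * conj (contraction idx r C U) =
      ∑ γ₁, ∑ γ₂, C γ₁ * conj (C γ₂) * ∏ i,
        (haarVec (r i) (U i) (idx i γ₁) * conj (haarVec (r i) (U i) (idx i γ₂))) := by
    rw [contraction, map_sum, Finset.sum_mul_sum]
    refine Finset.sum_congr rfl fun _ _ => Finset.sum_congr rfl fun _ _ => ?_
    simp only [map_mul, map_prod, Finset.prod_mul_distrib]
    ring
  have hi (γ₁ γ₂ : Γ) : Integrable (fun U : ∀ i, Matrix.unitaryGroup (κ i) ℂ =>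
      C γ₁ * conj (C γ₂) * ∏ i,
        (haarVec (r i) (U i) (idx i γ₁) * conj (haarVec (r i) (U i) (idx i γ₂))))
      (Measure.pi fun i => haarUnitary (κ i)) := by
    refine Integrable.const_mul (Integrable.fintype_prod_dep (f := fun i U =>
      haarVec (r i) U (idx i γ₁) * conj (haarVec (r i) U (idx i γ₂)))
      fun i => integrable_of_continuous ?_) _
    have := hc i
    fun_prop
  simp_rw [hexp]
  refine ⟨integrable_finsetSum _ fun _ _ => integrable_finsetSum _ fun _ _ => hi _ _, ?_⟩
  rw [integral_finsetSum _ fun _ _ => integrable_finsetSum _ fun _ _ => hi _ _]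
  refine Finset.sum_congr rfl fun _ _ => ?_
  rw [integral_finsetSum _ fun _ _ => hi _ _]
  refine Finset.sum_congr rfl fun _ _ => ?_
  rw [integral_const_mul]
  congr 1
  exact integral_fintype_prod_eq_prod (fun i U =>
    haarVec (r i) U (idx i _) * conj (haarVec (r i) U (idx i _)))

lemma integral_contraction_fourth (idx : ∀ i, Γ → κ i) (r : ∀ i, κ i → ℂ) (C : Γ → ℂ) :
    ∫ U, contraction idx r C U * contraction idx r C U * conj (contraction idx r C U) *
        conj (contraction idx r C U) ∂(Measure.pi fun i => haarUnitary (κ i)) =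
      ∑ γ₁, ∑ γ₂, ∑ γ₃, ∑ γ₄, C γ₁ * C γ₂ * conj (C γ₃) * conj (C γ₄) *
        ∏ i, fourthMoment (r i) (idx i γ₁) (idx i γ₂) (idx i γ₃) (idx i γ₄) := by
  have hc (i : V) := continuous_haarVec (r i)
  have hexp (U : ∀ i, Matrix.unitaryGroup (κ i) ℂ) :
      contraction idx r C U * contraction idx r C U * conj (contraction idx r C U) *
        conj (contraction idx r C U) =
      ∑ γ₁, ∑ γ₂, ∑ γ₃, ∑ γ₄, C γ₁ * C γ₂ * conj (C γ₃) * conj (C γ₄) * ∏ i,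
        (haarVec (r i) (U i) (idx i γ₁) * haarVec (r i) (U i) (idx i γ₂) *
          conj (haarVec (r i) (U i) (idx i γ₃)) * conj (haarVec (r i) (U i) (idx i γ₄))) := by
    calc _ = ∑ γ₁, ∑ γ₂, ∑ γ₃, ∑ γ₄, (C γ₁ * ∏ i, haarVec (r i) (U i) (idx i γ₁)) *
          (C γ₂ * ∏ i, haarVec (r i) (U i) (idx i γ₂)) *
          conj (C γ₃ * ∏ i, haarVec (r i) (U i) (idx i γ₃)) *
          conj (C γ₄ * ∏ i, haarVec (r i) (U i) (idx i γ₄)) := by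
          simp_rw [← Finset.mul_sum, ← Finset.sum_mul, ← Finset.mul_sum, ← Finset.sum_mul,
            contraction, map_sum]
          rw [Finset.sum_mul_sum]
      _ = _ := by
          refine Finset.sum_congr rfl fun _ _ => Finset.sum_congr rfl fun _ _ =>
            Finset.sum_congr rfl fun _ _ => Finset.sum_congr rfl fun _ _ => ?_
          simp only [map_mul, map_prod, Finset.prod_mul_distrib]
          ring
  have hi (γ₁ γ₂ γ₃ γ₄ : Γ) : Integrable (fun U : ∀ i, Matrix.unitaryGroup (κ i) ℂ =>
      C γ₁ * C γ₂ * conj (C γ₃) * conj (C γ₄) * ∏ i,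
        (haarVec (r i) (U i) (idx i γ₁) * haarVec (r i) (U i) (idx i γ₂) *
          conj (haarVec (r i) (U i) (idx i γ₃)) * conj (haarVec (r i) (U i) (idx i γ₄))))
      (Measure.pi fun i => haarUnitary (κ i)) := by
    refine Integrable.const_mul (Integrable.fintype_prod_dep (f := fun i U =>
      haarVec (r i) U (idx i γ₁) * haarVec (r i) U (idx i γ₂) *
          conj (haarVec (r i) U (idx i γ₃)) * conj (haarVec (r i) U (idx i γ₄)))
      fun i => integrable_of_continuous ?_) _
    have := hc i
    fun_prop
  simp_rw [hexp]
  rw [integral_finsetSum _ fun _ _ => integrable_finsetSum _ fun _ _ =>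
    integrable_finsetSum _ fun _ _ => integrable_finsetSum _ fun _ _ => hi _ _ _ _]
  refine Finset.sum_congr rfl fun _ _ => ?_
  rw [integral_finsetSum _ fun _ _ => integrable_finsetSum _ fun _ _ =>
    integrable_finsetSum _ fun _ _ => hi _ _ _ _]
  refine Finset.sum_congr rfl fun _ _ => ?_
  rw [integral_finsetSum _ fun _ _ => integrable_finsetSum _ fun _ _ => hi _ _ _ _]
  refine Finset.sum_congr rfl fun _ _ => ?_
  rw [integral_finsetSum _ fun _ _ => hi _ _ _ _]
  refine Finset.sum_congr rfl fun _ _ => ?_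
  rw [integral_const_mul]
  congr 1
  exact integral_fintype_prod_eq_prod (fun i U =>
    haarVec (r i) U (idx i _) * haarVec (r i) U (idx i _) *
      conj (haarVec (r i) U (idx i _)) * conj (haarVec (r i) U (idx i _)))

variable {X : L → Type*} [∀ l, Fintype (X l)]

/-- The second moment of a contraction factorizes over the legs. -/
theorem integral_contraction_sq_eq_prod_legs (inc : V → L → Prop) (hinc : ∀ l, ∃ i, inc i l)
    (idx : ∀ i, (∀ l, X l) → κ i)
    (hidx : ∀ i γ γ', idx i γ = idx i γ' ↔ ∀ l, inc i l → γ l = γ' l)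
    (r : ∀ i, κ i → ℂ) (hr : ∀ i, star (r i) ⬝ᵥ r i = 1) (f : ∀ l, X l → ℂ) :
    ∫ U, contraction idx r (fun γ => ∏ l, f l (γ l)) U *
        conj (contraction idx r (fun γ => ∏ l, f l (γ l)) U)
        ∂(Measure.pi fun i => haarUnitary (κ i)) =
      (∏ i, (Fintype.card (κ i) : ℂ)⁻¹) * ∏ l, ∑ x, f l x * conj (f l x) := by
  classical
  rw [(integral_contraction_sq idx r _).2, Fintype.prod_sum, Finset.mul_sum]
  refine Finset.sum_congr rfl fun γ₁ _ => ?_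
  simp_rw [fun i => secondMoment_eq (r i) (hr i)]
  -- Every leg meets some vertex, so configurations that agree at all vertices are equal.
  rw [Finset.sum_eq_single γ₁]
  · simp only [if_true, mul_one, Finset.prod_mul_distrib, map_prod]
    ring
  · intro γ₂ _ hne
    have : ¬ ∀ i, idx i γ₁ = idx i γ₂ := by
      intro h
      refine hne (funext fun l => ?_)
      obtain ⟨i, hi⟩ := hinc l
      exact (((hidx i _ _).mp (h i)) l hi).symm
    rw [Finset.prod_mul_distrib, Fintype.prod_ite_zero, if_neg this]
    simp
  · simp

lemma fourthMoment_eq_sum_paired {ι : Type*} [Fintype ι] [DecidableEq ι] (r : ι → ℂ)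
    (hr : star r ⬝ᵥ r = 1) (x x' y y' : ι) :
    fourthMoment r x x' y y' = ((Fintype.card ι : ℂ) * (Fintype.card ι + 1))⁻¹ *
      ∑ b, indicator (Paired b x x' y y') := by
  rw [fourthMoment_eq r hr, Fintype.sum_bool]
  simp only [indicator, Paired]
  congr

/-- The contribution of a single leg to the fourth moment. -/
def legWeight {Y : Type*} [Fintype Y] (g : Y → ℂ) (P : Bool → Prop) : ℂ :=
  ∑ x, ∑ x', ∑ y, ∑ y', g x * g x' * conj (g y) * conj (g y') *
    indicator (∀ b, P b → Paired b x x' y y')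

/-- The fourth moment of a contraction is a sum over the spins `σ` of products over the legs. -/
theorem integral_contraction_fourth_eq_sum_spins [DecidableEq V] (inc : V → L → Prop)
    (idx : ∀ i, (∀ l, X l) → κ i)
    (hidx : ∀ i γ γ', idx i γ = idx i γ' ↔ ∀ l, inc i l → γ l = γ' l)
    (r : ∀ i, κ i → ℂ) (hr : ∀ i, star (r i) ⬝ᵥ r i = 1) (f : ∀ l, X l → ℂ) :
    ∫ U, contraction idx r (fun γ => ∏ l, f l (γ l)) U *
        contraction idx r (fun γ => ∏ l, f l (γ l)) U *
        conj (contraction idx r (fun γ => ∏ l, f l (γ l)) U) *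
        conj (contraction idx r (fun γ => ∏ l, f l (γ l)) U)
        ∂(Measure.pi fun i => haarUnitary (κ i)) =
      (∏ i, ((Fintype.card (κ i) : ℂ) * (Fintype.card (κ i) + 1))⁻¹) *
        ∑ σ : V → Bool, ∏ l, legWeight (f l) fun b => ∃ i, inc i l ∧ σ i = b := by
  rw [integral_contraction_fourth]
  simp_rw [fun i => fourthMoment_eq_sum_paired (r i) (hr i), Finset.prod_mul_distrib,
    Fintype.prod_sum, legWeight, Fintype.prod_sum, prod_indicator, Finset.mul_sum]
  -- Each vertex imposes its pairing on all its legs; regrouped by legs, a leg feels only the set of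
  -- spins at its ends.
  have hpair (σ : V → Bool) (γ₁ γ₂ γ₃ γ₄ : ∀ l, X l) :
      (∀ i, Paired (σ i) (idx i γ₁) (idx i γ₂) (idx i γ₃) (idx i γ₄)) ↔
        ∀ l b, (∃ i, inc i l ∧ σ i = b) → Paired b (γ₁ l) (γ₂ l) (γ₃ l) (γ₄ l) := by
    have (i : V) : Paired (σ i) (idx i γ₁) (idx i γ₂) (idx i γ₃) (idx i γ₄) ↔
        ∀ l, inc i l → Paired (σ i) (γ₁ l) (γ₂ l) (γ₃ l) (γ₄ l) := by
      cases σ i <;> simp only [Paired, hidx] <;> grind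
    simp only [this]
    grind
  have hsplit (σ : V → Bool) (γ₁ γ₂ γ₃ γ₄ : ∀ l, X l) :
      ∏ l, (f l (γ₁ l) * f l (γ₂ l) * conj (f l (γ₃ l)) * conj (f l (γ₄ l)) *
        indicator (∀ b, (∃ i, inc i l ∧ σ i = b) → Paired b (γ₁ l) (γ₂ l) (γ₃ l) (γ₄ l))) =
      (∏ l, f l (γ₁ l)) * (∏ l, f l (γ₂ l)) * conj (∏ l, f l (γ₃ l)) * conj (∏ l, f l (γ₄ l)) *
        indicator (∀ i, Paired (σ i) (idx i γ₁) (idx i γ₂) (idx i γ₃) (idx i γ₄)) := by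
    simp only [Finset.prod_mul_distrib, prod_indicator, hpair, map_prod]
  simp_rw [hsplit]
  have hswap (F : (∀ l, X l) → (∀ l, X l) → (∀ l, X l) → (∀ l, X l) → (V → Bool) → ℂ) :
      ∑ γ₁, ∑ γ₂, ∑ γ₃, ∑ γ₄, ∑ σ, F γ₁ γ₂ γ₃ γ₄ σ =
        ∑ σ, ∑ γ₁, ∑ γ₂, ∑ γ₃, ∑ γ₄, F γ₁ γ₂ γ₃ γ₄ σ := by
    calc _ = ∑ γ₁, ∑ γ₂, ∑ γ₃, ∑ σ, ∑ γ₄, F γ₁ γ₂ γ₃ γ₄ σ :=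
          Finset.sum_congr rfl fun _ _ => Finset.sum_congr rfl fun _ _ =>
            Finset.sum_congr rfl fun _ _ => Finset.sum_comm
      _ = ∑ γ₁, ∑ γ₂, ∑ σ, ∑ γ₃, ∑ γ₄, F γ₁ γ₂ γ₃ γ₄ σ :=
          Finset.sum_congr rfl fun _ _ => Finset.sum_congr rfl fun _ _ => Finset.sum_comm
      _ = ∑ γ₁, ∑ σ, ∑ γ₂, ∑ γ₃, ∑ γ₄, F γ₁ γ₂ γ₃ γ₄ σ :=
          Finset.sum_congr rfl fun _ _ => Finset.sum_comm
      _ = _ := Finset.sum_comm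
  rw [hswap]
  refine Finset.sum_congr rfl fun _ _ => Finset.sum_congr rfl fun _ _ =>
    Finset.sum_congr rfl fun _ _ => Finset.sum_congr rfl fun _ _ =>
    Finset.sum_congr rfl fun _ _ => ?_
  ring

end Contraction

/-! ### Weights of single legs -/

section LegWeight

variable {Y : Type*} [Fintype Y]

/-- One pairing leaves two free indices, each summing to a squared norm. This covers physical legs,
logical legs and uncut bonds. -/
lemma legWeight_single (g : Y → ℂ) (P : Bool → Prop) (b : Bool) (hP : ∀ c, P c ↔ c = b) :
    legWeight g P = (∑ x, g x * conj (g x)) ^ 2 := by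
  classical
  simp only [legWeight, hP, forall_eq]
  rw [sq, Finset.sum_mul_sum]
  refine Finset.sum_congr rfl fun x _ => Finset.sum_congr rfl fun x' _ => ?_
  cases b
  · rw [Finset.sum_eq_single x', Finset.sum_eq_single x, indicator_of]
    · ring
    · simp [Paired]
    · intro y _ h
      rw [indicator_of_not, mul_zero]
      simp [Paired, h.symm]
    · simp
    · intro y _ h
      refine Finset.sum_eq_zero fun y' _ => ?_
      rw [indicator_of_not, mul_zero]
      simp [Paired, h.symm]
    · simp
  · rw [Finset.sum_eq_single x, Finset.sum_eq_single x', indicator_of]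
    · ring
    · simp [Paired]
    · intro y _ h
      rw [indicator_of_not, mul_zero]
      simp [Paired, h.symm]
    · simp
    · intro y _ h
      refine Finset.sum_eq_zero fun y' _ => ?_
      rw [indicator_of_not, mul_zero]
      simp [Paired, h.symm]
    · simp

/-- Both pairings together force all four indices to coincide, so one free index remains. This is
the case of a cut bond. -/
lemma legWeight_one_both (P : Bool → Prop) (hP : ∀ c, P c) :
    legWeight (fun _ : Y => (1 : ℂ)) P = Fintype.card Y := by
  classical
  have h (x x' y y' : Y) : (∀ b, P b → Paired b x x' y y') ↔ x' = x ∧ y = x ∧ y' = x := by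
    simp only [hP, forall_const, Bool.forall_bool, Paired]
    grind
  simp only [legWeight, h, indicator]
  simp [ite_and]

end LegWeight

/-! ### The Ising inequality -/

section SpinSum

/-- The edge `e` is cut by the spin configuration `σ`. -/
def IsCut {V E : Type*} (inc : V → E → Prop) (σ : V → Bool) (e : E) : Prop :=
  ∀ b, ∃ i, inc i e ∧ σ i = b

variable {V E : Type*} [Fintype V] [DecidableEq V] [Fintype E]

lemma prod_one_add_eq_sum_spins (z : V → ℝ) :
    ∏ i, (1 + z i) = ∑ σ : V → Bool, ∏ i, if σ i then z i else 1 := by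
  rw [← Fintype.prod_sum fun i (b : Bool) => if b then z i else 1]
  simp [add_comm]

lemma sum_spins_not (F : (V → Bool) → ℝ) :
    ∑ σ : V → Bool, F (fun i => !σ i) = ∑ σ, F σ :=
  Fintype.sum_equiv (Equiv.piCongrRight fun _ => Equiv.boolNot) _ _ fun _ => rfl

open Classical in
-- A cut edge has an up endpoint, which already supplies one factor `w e`; all further factors are
-- at most 1.
lemma prod_incident_le_prod_cut (inc : V → E → Prop) (w : E → ℝ) (hw0 : ∀ e, 0 ≤ w e)
    (hw1 : ∀ e, w e ≤ 1) (σ : V → Bool) :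
    (∏ i, if σ i then ∏ e, (if inc i e then w e else 1) else 1) ≤
      ∏ e, if IsCut inc σ e then w e else 1 := by
  have h (i : V) : (if σ i then ∏ e, (if inc i e then w e else 1) else 1) =
      ∏ e, if σ i = true ∧ inc i e then w e else 1 := by
    by_cases hs : σ i <;> simp [hs]
  simp_rw [h]
  rw [Finset.prod_comm]
  have h0 (e : E) (i : V) : 0 ≤ if σ i = true ∧ inc i e then w e else 1 := by
    split_ifs <;> simp [hw0]
  have h1 (e : E) (i : V) : (if σ i = true ∧ inc i e then w e else 1) ≤ 1 := by
    split_ifs <;> simp [hw1]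
  refine Finset.prod_le_prod (fun e _ => Finset.prod_nonneg fun i _ => h0 e i) fun e _ => ?_
  by_cases hcut : IsCut inc σ e
  · obtain ⟨i, hi, hs⟩ := hcut true
    rw [if_pos hcut, ← Finset.mul_prod_erase _ _ (Finset.mem_univ i), if_pos ⟨hs, hi⟩]
    exact mul_le_of_le_one_right (hw0 e)
      (Finset.prod_le_one (fun j _ => h0 e j) fun j _ => h1 e j)
  · rw [if_neg hcut]
    exact Finset.prod_le_one (fun j _ => h0 e j) fun j _ => h1 e j

open Classical in
/-- A lower bound on an Ising partition function with couplings `w`. -/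
theorem two_mul_prod_le_spin_sum (inc : V → E → Prop) (w : E → ℝ) (hw0 : ∀ e, 0 ≤ w e)
    (hw1 : ∀ e, w e ≤ 1) (x : V → ℝ) (hx0 : ∀ i, 0 ≤ x i) (hx1 : ∀ i, x i ≤ 1) :
    2 * ∏ i, (1 + x i * ∏ e, if inc i e then w e else 1) ≤
      (1 + ∏ i, x i) * ∑ σ : V → Bool, ∏ e, if IsCut inc σ e then w e else 1 := by
  set z : (V → Bool) → ℝ := fun σ => ∏ e, if IsCut inc σ e then w e else 1 with hz
  set X : (V → Bool) → ℝ := fun σ => ∏ i, if σ i then x i else 1 with hX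
  have hz0 (σ : V → Bool) : 0 ≤ z σ :=
    Finset.prod_nonneg fun e _ => by split_ifs <;> simp [hw0]
  have hX0 (σ : V → Bool) : 0 ≤ X σ :=
    Finset.prod_nonneg fun e _ => by split_ifs <;> simp [hx0]
  have hX1 (σ : V → Bool) : X σ ≤ 1 :=
    Finset.prod_le_one (fun e _ => by split_ifs <;> simp [hx0])
      fun e _ => by split_ifs <;> simp [hx1]
  have hzneg (σ : V → Bool) : z (fun i => !σ i) = z σ := by
    have : ∀ e, IsCut inc (fun i => !σ i) e ↔ IsCut inc σ e := fun e => by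
      simp only [IsCut, Bool.forall_bool, Bool.not_eq_false', Bool.not_eq_true']
      exact and_comm
    simp only [hz, this]
  have hXneg (σ : V → Bool) : X σ * X (fun i => !σ i) = ∏ i, x i := by
    simp only [hX]
    rw [← Finset.prod_mul_distrib]
    refine Finset.prod_congr rfl fun i _ => ?_
    by_cases h : σ i <;> simp [h]
  have hexp : ∏ i, (1 + x i * ∏ e, if inc i e then w e else 1) ≤ ∑ σ, X σ * z σ := by
    rw [prod_one_add_eq_sum_spins]
    refine Finset.sum_le_sum fun σ _ => ?_
    calc _ = X σ * ∏ i, (if σ i then ∏ e, (if inc i e then w e else 1) else 1) := by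
          simp only [hX]
          rw [← Finset.prod_mul_distrib]
          refine Finset.prod_congr rfl fun i _ => ?_
          by_cases h : σ i <;> simp [h]
      _ ≤ _ := mul_le_mul_of_nonneg_left (prod_incident_le_prod_cut inc w hw0 hw1 σ) (hX0 σ)
  calc _ ≤ 2 * ∑ σ, X σ * z σ := by linarith
    -- One of the two copies is reindexed by the global spin flip, which preserves cuts.
    _ = ∑ σ, (X σ + X fun i => !σ i) * z σ := by
      simp_rw [add_mul, Finset.sum_add_distrib]
      rw [two_mul, ← sum_spins_not fun σ => X σ * z σ]
      simp only [hzneg]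
    _ ≤ ∑ σ, (1 + ∏ i, x i) * z σ := by
      refine Finset.sum_le_sum fun σ _ => mul_le_mul_of_nonneg_right ?_ (hz0 σ)
      rw [← hXneg σ]
      -- This is `0 ≤ (1 - X σ) * (1 - X σ')` with `σ'` the flipped configuration.
      nlinarith [hX1 σ, hX1 fun i => !σ i]
    _ = _ := by rw [Finset.mul_sum]

end SpinSum

/-! ### Networks as contractions over legs -/

namespace Network

variable {V : Type*} {a n : ℕ}

/-- The legs of a network: physical, logical and internal. -/
abbrev Leg (N : Network V a n) : Type _ := Fin n ⊕ V ⊕ N.graph.edgeSet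

/-- The dimension of a leg. -/
def legDim (N : Network V a n) : N.Leg → ℕ
  | .inl _ => a
  | .inr (.inl k) => N.logDim k
  | .inr (.inr e) => N.bondDim e

/-- The leg is attached to the vertex. -/
def Inc (N : Network V a n) (i : V) : N.Leg → Prop
  | .inl s => N.site s = i
  | .inr (.inl k) => k = i
  | .inr (.inr e) => i ∈ e.1

/-- The restriction of a configuration of the legs to the legs of a tensor. -/
def restrict (N : Network V a n) (i : V) (γ : ∀ l, Fin (N.legDim l)) : N.TensorIdx i :=
  (fun x => γ (.inl x), γ (.inr (.inl i)), fun j => γ (.inr (.inr (N.edgeTo i j))))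

/-- The coefficients of product vectors, as functions on the legs. -/
def legCoeff (N : Network V a n) (F : (k : V) → EuclideanSpace ℂ (Fin (N.logDim k)))
    (g : Fin n → EuclideanSpace ℂ (Fin a)) : ∀ l, Fin (N.legDim l) → ℂ
  | .inl s => fun x => conj (g s x)
  | .inr (.inl k) => fun x => conj (F k x)
  | .inr (.inr _) => fun _ => 1

lemma exists_inc (N : Network V a n) (l : N.Leg) : ∃ i, N.Inc i l := by
  rcases l with s | k | e
  · exact ⟨N.site s, rfl⟩
  · exact ⟨k, rfl⟩
  · exact ⟨e.1.out.1, Sym2.out_fst_mem _⟩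

lemma sum_legCoeff_site (N : Network V a n)
    (F : (k : V) → EuclideanSpace ℂ (Fin (N.logDim k)))
    (g : Fin n → EuclideanSpace ℂ (Fin a)) (s : Fin n) :
    ∑ x, N.legCoeff F g (.inl s) x * conj (N.legCoeff F g (.inl s) x) =
      ∑ x, g s x * conj (g s x) := by
  simp only [legCoeff, Complex.conj_conj, mul_comm]
  rfl

lemma sum_legCoeff_logical (N : Network V a n)
    (F : (k : V) → EuclideanSpace ℂ (Fin (N.logDim k)))
    (g : Fin n → EuclideanSpace ℂ (Fin a)) (k : V) :
    ∑ x, N.legCoeff F g (.inr (.inl k)) x * conj (N.legCoeff F g (.inr (.inl k)) x) =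
      ∑ x, F k x * conj (F k x) := by
  simp only [legCoeff, Complex.conj_conj, mul_comm]
  rfl

lemma sum_legCoeff_bond (N : Network V a n)
    (F : (k : V) → EuclideanSpace ℂ (Fin (N.logDim k)))
    (g : Fin n → EuclideanSpace ℂ (Fin a)) (e : N.graph.edgeSet) :
    ∑ x, N.legCoeff F g (.inr (.inr e)) x * conj (N.legCoeff F g (.inr (.inr e)) x) =
      N.bondDim e := by
  simp only [legCoeff, map_one, mul_one, Finset.sum_const, nsmul_eq_mul, Finset.card_univ,
    Fintype.card_fin]
  rfl

lemma restrict_eq_iff (N : Network V a n) (i : V) (γ γ' : ∀ l, Fin (N.legDim l)) :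
    N.restrict i γ = N.restrict i γ' ↔ ∀ l, N.Inc i l → γ l = γ' l := by
  constructor
  · intro h
    rintro (s | k | ⟨e, he⟩) hl
    · exact congrFun (congrArg Prod.fst h) ⟨s, hl⟩
    · obtain rfl : k = i := hl
      exact congrArg (fun t => t.2.1) h
    · obtain ⟨j, rfl⟩ := Sym2.mem_iff_exists.mp (show i ∈ e from hl)
      exact congrFun (congrArg (fun t => t.2.2) h) ⟨j, he⟩
  · intro h
    exact Prod.ext (funext fun x => h (.inl x) x.2) (Prod.ext (h (.inr (.inl i)) rfl)
      (funext fun j => h (.inr (.inr (N.edgeTo i j))) (Sym2.mem_mk_left _ _)))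

end Network

lemma sum_pi_sum {A B : Type*} [Fintype A] [Fintype B] [DecidableEq A] [DecidableEq B]
    {X : A ⊕ B → Type*} [∀ l, Fintype (X l)] (F : (∀ l, X l) → ℂ) :
    ∑ γ, F γ = ∑ p : (∀ i, X (.inl i)), ∑ q : (∀ i, X (.inr i)),
      F ((Equiv.sumPiEquivProdPi X).symm (p, q)) := by
  rw [← Fintype.sum_prod_type (f := fun z => F ((Equiv.sumPiEquivProdPi X).symm z))]
  exact Fintype.sum_equiv (Equiv.sumPiEquivProdPi X) _ _ fun γ => by
    rw [Equiv.symm_apply_apply]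

/-- The factors of a product unit vector need not be normalized; only the product of their norms is
1, which suffices because the legs enter through a product. -/
lemma prod_sum_mul_conj {K : Type*} [Fintype K] [DecidableEq K] {d : K → ℕ}
    (v : EuclideanSpace ℂ ((k : K) → Fin (d k))) (f : (k : K) → EuclideanSpace ℂ (Fin (d k)))
    (h : ∀ c, v c = ∏ k, f k (c k)) (hv : ‖v‖ = 1) :
    ∏ k, ∑ x, f k x * conj (f k x) = 1 := by
  rw [Fintype.prod_sum]
  simp_rw [Finset.prod_mul_distrib, ← map_prod, ← h, Complex.mul_conj']
  have : ∑ c, ‖v c‖ ^ 2 = 1 := by rw [← EuclideanSpace.norm_sq_eq, hv, one_pow]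
  exact_mod_cast this

lemma star_dotProduct_self {K : Type*} [Fintype K] (v : EuclideanSpace ℂ K) (hv : ‖v‖ = 1) :
    star v.ofLp ⬝ᵥ v.ofLp = 1 := by
  have : ∑ c, ‖v c‖ ^ 2 = 1 := by rw [← EuclideanSpace.norm_sq_eq, hv, one_pow]
  simp only [dotProduct, Pi.star_apply, RCLike.star_def, Complex.conj_mul']
  exact_mod_cast this

namespace Network

variable {V : Type*} [Fintype V] [DecidableEq V] {a n : ℕ}

open Classical in
-- Unentangledness enters here: the coefficients factor over legs, as the moment formulas require.
lemma inner_randomState_eq (N : Network V a n) (ref : (i : V) → EuclideanSpace ℂ (N.TensorIdx i))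
    (Φ : N.BulkSpace) (φ : PhysSpace a n) (F : (k : V) → EuclideanSpace ℂ (Fin (N.logDim k)))
    (g : Fin n → EuclideanSpace ℂ (Fin a)) (hF : ∀ c, Φ c = ∏ k, F k (c k))
    (hg : ∀ s, φ s = ∏ k, g k (s k)) (U : (i : V) → Matrix.unitaryGroup (N.TensorIdx i) ℂ) :
    inner ℂ φ (N.randomState Φ ref U) =
      contraction N.restrict (fun i => (ref i).ofLp)
        (fun γ => ∏ l, N.legCoeff F g l (γ l)) U := by
  rw [contraction, sum_pi_sum, PiLp.inner_apply]
  refine Finset.sum_congr rfl fun s _ => ?_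
  rw [sum_pi_sum (A := V)]
  simp only [randomState, state, RCLike.inner_apply, Finset.sum_mul]
  refine Finset.sum_congr rfl fun c _ => ?_
  refine Finset.sum_congr (by congr!) fun β _ => ?_
  rw [hF, hg]
  simp [legCoeff, Fintype.prod_sum_type, Equiv.sumPiEquivProdPi, tensor, haarVec, restrict,
    map_prod]
  ring

end Network

/-! ### The effective dimension as an Ising partition function -/

namespace Network

variable {V : Type*} [Fintype V] [DecidableEq V] {a n : ℕ}

open Classical in
lemma card_tensorIdx (N : Network V a n) (i : V) :
    Fintype.card (N.TensorIdx i) = (∏ s, if N.site s = i then a else 1) * N.logDim i *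
      ∏ e, if i ∈ e.1 then N.bondDim e else 1 := by
  have h1 : ∏ j : N.graph.neighborSet i, N.bondDim (N.edgeTo i j) =
      ∏ e, if i ∈ e.1 then N.bondDim e else 1 := by
    refine Fintype.prod_of_injective (N.edgeTo i) ?_ _ _ ?_ ?_
    · intro j k h
      have := congrArg Subtype.val h
      exact Subtype.ext (Sym2.congr_right.mp this)
    · rintro ⟨e, he⟩ h
      rw [if_neg]
      intro hi
      obtain ⟨j, rfl⟩ := Sym2.mem_iff_exists.mp hi
      exact h ⟨⟨j, he⟩, rfl⟩
    · intro j
      exact (if_pos (Sym2.mem_mk_left _ _)).symm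
  rw [← h1, Finset.prod_ite, Finset.prod_const, Finset.prod_const_one, mul_one]
  simp only [Fintype.card_prod, Fintype.card_pi, Fintype.card_fin, Finset.prod_const,
    Finset.card_univ, ← Fintype.card_subtype, mul_assoc]
  congr!

variable (N : Network V a n) (ref : (i : V) → EuclideanSpace ℂ (N.TensorIdx i))
  (Φ : N.BulkSpace) (φ : PhysSpace a n)

/-- An internal edge whose ends carry different spins. -/
def EdgeCut (σ : V → Bool) (e : N.graph.edgeSet) : Prop :=
  IsCut (fun i (e : N.graph.edgeSet) => i ∈ e.1) σ e

open Classical in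
lemma integral_norm_sq_inner (href : ∀ i, ‖ref i‖ = 1) (hΦ : ‖Φ‖ = 1) (hΦu : IsUnentangled Φ)
    (hφ : ‖φ‖ = 1) (hφu : IsUnentangled φ) :
    Integrable (fun U => ‖inner ℂ φ (N.randomState Φ ref U)‖ ^ 2) N.law ∧
    ∫ U, ‖inner ℂ φ (N.randomState Φ ref U)‖ ^ 2 ∂N.law =
      (∏ i, (Fintype.card (N.TensorIdx i) : ℝ)⁻¹) * ∏ e, (N.bondDim e : ℝ) := by
  obtain ⟨F, hF⟩ := hΦu
  obtain ⟨g, hg⟩ := hφu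
  have h1 := prod_sum_mul_conj Φ F hF hΦ
  have h2 := prod_sum_mul_conj φ g hg hφ
  have hc (U) : ((‖inner ℂ φ (N.randomState Φ ref U)‖ ^ 2 : ℝ) : ℂ) = _ :=
    (by rw [← N.inner_randomState_eq ref Φ φ F g hF hg U, Complex.mul_conj']; push_cast; rfl :
      _ = contraction N.restrict (fun i => (ref i).ofLp)
        (fun γ => ∏ l, N.legCoeff F g l (γ l)) U * conj (contraction N.restrict
          (fun i => (ref i).ofLp) (fun γ => ∏ l, N.legCoeff F g l (γ l)) U))
  constructor
  · have := (integral_contraction_sq N.restrict (fun i => (ref i).ofLp)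
        (fun γ => ∏ l, N.legCoeff F g l (γ l))).1
    simp_rw [← hc] at this
    exact this.re
  · rw [← Complex.ofReal_inj, ← integral_complex_ofReal]
    simp_rw [hc]
    rw [law, integral_contraction_sq_eq_prod_legs N.Inc N.exists_inc N.restrict N.restrict_eq_iff
      _ (fun i => star_dotProduct_self _ (href i))]
    rw [Fintype.prod_sum_type, Fintype.prod_sum_type]
    simp_rw [N.sum_legCoeff_site, N.sum_legCoeff_logical, N.sum_legCoeff_bond, h1, h2, one_mul]
    push_cast
    rfl

open Classical in
lemma integral_norm_fourth_inner (href : ∀ i, ‖ref i‖ = 1) (hΦ : ‖Φ‖ = 1)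
    (hΦu : IsUnentangled Φ) (hφ : ‖φ‖ = 1) (hφu : IsUnentangled φ) :
    ∫ U, ‖inner ℂ φ (N.randomState Φ ref U)‖ ^ 4 ∂N.law =
      (∏ i, ((Fintype.card (N.TensorIdx i) : ℝ) * (Fintype.card (N.TensorIdx i) + 1))⁻¹) *
        ∑ σ : V → Bool, ∏ e, if N.EdgeCut σ e then (N.bondDim e : ℝ) else N.bondDim e ^ 2 := by
  obtain ⟨F, hF⟩ := hΦu
  obtain ⟨g, hg⟩ := hφu
  have h1 := prod_sum_mul_conj Φ F hF hΦ
  have h2 := prod_sum_mul_conj φ g hg hφ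
  rw [← Complex.ofReal_inj, ← integral_complex_ofReal]
  have hz (z : ℂ) : ((‖z‖ ^ 4 : ℝ) : ℂ) = z * z * conj z * conj z := by
    have : ((‖z‖ ^ 4 : ℝ) : ℂ) = (z * conj z) ^ 2 := by
      rw [Complex.mul_conj']; push_cast; ring
    rw [this]; ring
  simp_rw [hz, N.inner_randomState_eq ref Φ φ F g hF hg]
  rw [law, integral_contraction_fourth_eq_sum_spins N.Inc N.restrict N.restrict_eq_iff
    _ (fun i => star_dotProduct_self _ (href i))]
  push_cast
  congr 1
  refine Finset.sum_congr rfl fun σ _ => ?_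
  rw [Fintype.prod_sum_type, Fintype.prod_sum_type]
  have hs (s : Fin n) : legWeight (N.legCoeff F g (.inl s))
      (fun b => ∃ i, N.Inc i (.inl s) ∧ σ i = b) = (∑ x, g s x * conj (g s x)) ^ 2 := by
    rw [legWeight_single _ _ (σ (N.site s))]
    · rw [N.sum_legCoeff_site]
    · intro c
      simp [Inc, eq_comm]
  have hk (k : V) : legWeight (N.legCoeff F g (.inr (.inl k)))
      (fun b => ∃ i, N.Inc i (.inr (.inl k)) ∧ σ i = b) = (∑ x, F k x * conj (F k x)) ^ 2 := by
    rw [legWeight_single _ _ (σ k)]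
    · rw [N.sum_legCoeff_logical]
    · intro c
      simp [Inc, eq_comm]
  have he (e : N.graph.edgeSet) : legWeight (N.legCoeff F g (.inr (.inr e)))
      (fun b => ∃ i, N.Inc i (.inr (.inr e)) ∧ σ i = b) =
        if N.EdgeCut σ e then (N.bondDim e : ℂ) else N.bondDim e ^ 2 := by
    by_cases hcut : N.EdgeCut σ e
    · rw [if_pos hcut]
      refine (legWeight_one_both _ hcut).trans ?_
      rw [Fintype.card_fin]
      rfl
    · rw [if_neg hcut]
      obtain ⟨i, hi⟩ := N.exists_inc (.inr (.inr e))
      rw [legWeight_single _ _ (σ i)]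
      · rw [N.sum_legCoeff_bond]
      · intro c
        refine ⟨?_, fun h => ⟨i, hi, h.symm⟩⟩
        rintro ⟨j, hj, rfl⟩
        -- Two different spins among the endpoints would realize both values, and the edge would be
        -- cut.
        by_contra hne
        refine hcut fun b => ?_
        by_cases hb : σ i = b
        · exact ⟨i, hi, hb⟩
        · exact ⟨j, hj, by
            revert hne hb; cases σ i <;> cases σ j <;> cases b <;> simp⟩
  simp_rw [hs, hk, he, Finset.prod_pow, h1, h2, one_pow, one_mul]
  refine Finset.prod_congr rfl fun e _ => ?_
  split_ifs <;> push_cast <;> rfl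

open Classical in
-- The computational basis consists of product vectors, and all `a ^ n` of them have the same mean
-- squared overlap.
lemma integral_norm_sq_randomState (href : ∀ i, ‖ref i‖ = 1) (hΦ : ‖Φ‖ = 1)
    (hΦu : IsUnentangled Φ) :
    ∫ U, ‖N.randomState Φ ref U‖ ^ 2 ∂N.law =
      (a : ℝ) ^ n * ((∏ i, (Fintype.card (N.TensorIdx i) : ℝ)⁻¹) * ∏ e, (N.bondDim e : ℝ)) := by
  have hb (s : Fin n → Fin a) := N.integral_norm_sq_inner ref Φ (EuclideanSpace.single s 1)
    href hΦ hΦu (by simp) ⟨fun k => EuclideanSpace.single (s k) 1, fun c => by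
      simp [PiLp.single_apply, Fintype.prod_ite_zero, funext_iff]⟩
  simp only [EuclideanSpace.inner_single_left, map_one, one_mul] at hb
  simp_rw [EuclideanSpace.norm_sq_eq]
  rw [integral_finsetSum _ fun s _ => (hb s).1, Finset.sum_congr rfl fun s _ => (hb s).2]
  simp

open Classical in
/-- The inverse effective dimension is the partition function of an Ising model. -/
theorem invEffDim_eq (ha : 1 ≤ a) (href : ∀ i, ‖ref i‖ = 1) (hΦ : ‖Φ‖ = 1)
    (hΦu : IsUnentangled Φ) (hφ : ‖φ‖ = 1) (hφu : IsUnentangled φ) :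
    N.invEffDim ref Φ φ = ((a : ℝ) ^ n)⁻¹ *
      (∏ i, (1 + (Fintype.card (N.TensorIdx i) : ℝ)⁻¹))⁻¹ *
        ∑ σ : V → Bool, ∏ e, if N.EdgeCut σ e then (N.bondDim e : ℝ)⁻¹ else 1 := by
  have hb (e) : (N.bondDim e : ℝ) ≠ 0 := by
    have := N.bondDim_pos e
    positivity
  have hB : ∏ e, (N.bondDim e : ℝ) ≠ 0 := Finset.prod_ne_zero_iff.mpr fun e _ => hb e
  have hd (i) : (Fintype.card (N.TensorIdx i) : ℝ) ≠ 0 := by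
    have := N.logDim_pos i
    rw [N.card_tensorIdx i, Nat.cast_ne_zero]
    refine mul_ne_zero (mul_ne_zero (Finset.prod_ne_zero_iff.mpr fun s _ => ?_) (by lia))
      (Finset.prod_ne_zero_iff.mpr fun e _ => ?_)
    · split_ifs <;> lia
    · have := N.bondDim_pos e
      split_ifs <;> lia
  have hA : (a : ℝ) ^ n ≠ 0 := by positivity
  have hsum : ∑ σ : V → Bool, ∏ e, (if N.EdgeCut σ e then (N.bondDim e : ℝ)⁻¹ else 1) =
      (∑ σ : V → Bool, ∏ e, if N.EdgeCut σ e then (N.bondDim e : ℝ) else N.bondDim e ^ 2) *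
        ((∏ e, (N.bondDim e : ℝ)) ^ 2)⁻¹ := by
    rw [Finset.sum_mul]
    refine Finset.sum_congr rfl fun σ _ => ?_
    rw [← Finset.prod_pow, ← Finset.prod_inv_distrib, ← Finset.prod_mul_distrib]
    refine Finset.prod_congr rfl fun e _ => ?_
    have := hb e
    split_ifs <;> field_simp
  -- Here `D (D + 1) = D ^ 2 * (1 + 1 / D)`; the squares cancel against the squared second moment.
  have hprod : ∏ i, ((Fintype.card (N.TensorIdx i) : ℝ) * (Fintype.card (N.TensorIdx i) + 1))⁻¹ =
      (∏ i, (1 + (Fintype.card (N.TensorIdx i) : ℝ)⁻¹))⁻¹ *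
        (∏ i, (Fintype.card (N.TensorIdx i) : ℝ)⁻¹) ^ 2 := by
    rw [← Finset.prod_pow, ← Finset.prod_inv_distrib, ← Finset.prod_mul_distrib]
    refine Finset.prod_congr rfl fun i _ => ?_
    have := hd i
    field_simp
  have hI : ∏ i, (Fintype.card (N.TensorIdx i) : ℝ)⁻¹ ≠ 0 :=
    Finset.prod_ne_zero_iff.mpr fun i _ => inv_ne_zero (hd i)
  rw [invEffDim, N.integral_norm_sq_randomState ref Φ href hΦ hΦu]
  simp_rw [norm_inner_symm _ φ]
  rw [N.integral_norm_fourth_inner ref Φ φ href hΦ hΦu hφ hφu, hsum, hprod]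
  generalize (∑ σ : V → Bool, ∏ e, if N.EdgeCut σ e then (N.bondDim e : ℝ) else N.bondDim e ^ 2) =
    S
  generalize (∏ i, (1 + (Fintype.card (N.TensorIdx i) : ℝ)⁻¹))⁻¹ = P
  generalize ∏ i, (Fintype.card (N.TensorIdx i) : ℝ)⁻¹ = I at hI
  generalize ∏ e, (N.bondDim e : ℝ) = B at hB
  generalize (a : ℝ) ^ n = A at hA
  field_simp

theorem two_div_le_invEffDim (ha : 1 ≤ a) (href : ∀ i, ‖ref i‖ = 1) (hΦ : ‖Φ‖ = 1)
    (hΦu : IsUnentangled Φ) (hφ : ‖φ‖ = 1) (hφu : IsUnentangled φ) :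
    2 / ((a : ℝ) ^ n + 1) ≤ N.invEffDim ref Φ φ := by
  classical
  rw [N.invEffDim_eq ref Φ φ ha href hΦ hΦu hφ hφu]
  have ha' : (1 : ℝ) ≤ a := by exact_mod_cast ha
  have hd (i) : (1 : ℝ) ≤ N.logDim i := by exact_mod_cast N.logDim_pos i
  -- The part of `1 / D_i` due to non-bond legs, so that the bond factors complete it in `hcard`.
  set x : V → ℝ := fun i => (∏ s, if N.site s = i then (a : ℝ)⁻¹ else 1) * (N.logDim i : ℝ)⁻¹
    with hx
  have hsite0 (s i) : 0 ≤ if N.site s = i then (a : ℝ)⁻¹ else 1 := by split_ifs <;> positivity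
  have hsite1 (s i) : (if N.site s = i then (a : ℝ)⁻¹ else 1) ≤ 1 := by
    split_ifs
    · exact inv_le_one_of_one_le₀ ha'
    · exact le_rfl
  have key := two_mul_prod_le_spin_sum (fun i (e : N.graph.edgeSet) => i ∈ e.1)
    (fun e => (N.bondDim e : ℝ)⁻¹) (fun e => by positivity)
    (fun e => inv_le_one_of_one_le₀ (by exact_mod_cast N.bondDim_pos e)) x
    (fun i => mul_nonneg (Finset.prod_nonneg fun s _ => hsite0 s i) (by positivity))
    (fun i => mul_le_one₀ (Finset.prod_le_one (fun s _ => hsite0 s i) fun s _ => hsite1 s i)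
      (by positivity) (inv_le_one_of_one_le₀ (hd i)))
  -- Each site belongs to exactly one vertex and contributes one `a⁻¹`; logical legs only decrease
  -- the product.
  have hxprod : ∏ i, x i ≤ ((a : ℝ) ^ n)⁻¹ := by
    simp only [hx]
    rw [Finset.prod_mul_distrib, Finset.prod_comm]
    simp only [Finset.prod_ite_eq, Finset.mem_univ, if_true, Finset.prod_const, Finset.card_univ,
      Fintype.card_fin, inv_pow]
    exact mul_le_of_le_one_right (by positivity)
      (Finset.prod_le_one (fun i _ => by positivity) fun i _ => inv_le_one_of_one_le₀ (hd i))
  have hcard (i) (dec : ∀ e : N.graph.edgeSet, Decidable (i ∈ e.1)) :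
      x i * (∏ e : N.graph.edgeSet, if i ∈ e.1 then (N.bondDim e : ℝ)⁻¹ else 1) =
        (Fintype.card (N.TensorIdx i) : ℝ)⁻¹ := by
    rw [N.card_tensorIdx i, hx]
    push_cast
    rw [mul_inv, mul_inv, ← Finset.prod_inv_distrib, ← Finset.prod_inv_distrib]
    simp only [apply_ite Inv.inv, inv_one]
  replace key : 2 * ∏ i, (1 + (Fintype.card (N.TensorIdx i) : ℝ)⁻¹) ≤ (1 + ∏ i, x i) *
      ∑ σ : V → Bool, ∏ e, (if N.EdgeCut σ e then (N.bondDim e : ℝ)⁻¹ else 1) := by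
    simp_rw [← fun i => hcard i inferInstance]
    convert key
    rfl
  set Z := ∑ σ : V → Bool, ∏ e, (if N.EdgeCut σ e then (N.bondDim e : ℝ)⁻¹ else 1)
  have hZ : 0 ≤ Z := Finset.sum_nonneg fun σ _ => Finset.prod_nonneg fun e _ => by
    split_ifs <;> positivity
  set P := ∏ i, (1 + (Fintype.card (N.TensorIdx i) : ℝ)⁻¹)
  have hP : 0 < P := Finset.prod_pos fun i _ => by positivity
  have hA : (0 : ℝ) < (a : ℝ) ^ n := by positivity
  have h2 : 2 * P ≤ (1 + ((a : ℝ) ^ n)⁻¹) * Z :=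
    key.trans (mul_le_mul_of_nonneg_right (by linarith) hZ)
  rw [div_le_iff₀ (by positivity)]
  calc (2 : ℝ) = P⁻¹ * (2 * P) := by field_simp
    _ ≤ P⁻¹ * ((1 + ((a : ℝ) ^ n)⁻¹) * Z) := mul_le_mul_of_nonneg_left h2 (by positivity)
    _ = _ := by field_simp

end Network

/-- Without edges both spin values have weight 1, so the partition function is 2, and `D = a ^ n`.
-/
theorem invEffDim_singleTensor (a n : ℕ) (ha : 1 ≤ a)
    (ref : (i : Unit) → EuclideanSpace ℂ ((singleTensor a n).TensorIdx i))
    (Φ : (singleTensor a n).BulkSpace) (φ : PhysSpace a n) (href : ∀ i, ‖ref i‖ = 1)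
    (hΦ : ‖Φ‖ = 1) (hΦu : IsUnentangled Φ) (hφ : ‖φ‖ = 1) (hφu : IsUnentangled φ) :
    (singleTensor a n).invEffDim ref Φ φ = 2 / ((a : ℝ) ^ n + 1) := by
  classical
  rw [Network.invEffDim_eq _ ref Φ φ ha href hΦ hΦu hφ hφu]
  have hE : IsEmpty (singleTensor a n).graph.edgeSet := by
    simp [singleTensor]
  have hA : (a : ℝ) ^ n ≠ 0 := by positivity
  have hcard (i : Unit) : Fintype.card ((singleTensor a n).TensorIdx i) = a ^ n := by
    rw [Network.card_tensorIdx]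
    simp [singleTensor]
  simp_rw [hcard]
  simp
  field_simp

end RandomTensorNetwork

end

theorem mainTheorem3 (a n : ℕ) (ha : 1 ≤ a) :
    (∀ {V : Type*} [Fintype V] [DecidableEq V] (N : RandomTensorNetwork.Network V a n)
        (ref : (i : V) → EuclideanSpace ℂ (N.TensorIdx i))
        (Φ : N.BulkSpace) (φ : RandomTensorNetwork.PhysSpace a n),
        (∀ i, ‖ref i‖ = 1) →
        ‖Φ‖ = 1 → RandomTensorNetwork.IsUnentangled Φ →
        ‖φ‖ = 1 → RandomTensorNetwork.IsUnentangled φ →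
        2 / ((a : ℝ) ^ n + 1) ≤ N.invEffDim ref Φ φ ∧
        N.effDim ref Φ φ ≤ ((a : ℝ) ^ n + 1) / 2) ∧
    (∀ (ref : (i : Unit) →
          EuclideanSpace ℂ ((RandomTensorNetwork.singleTensor a n).TensorIdx i))
        (Φ : (RandomTensorNetwork.singleTensor a n).BulkSpace)
        (φ : RandomTensorNetwork.PhysSpace a n),
        (∀ i, ‖ref i‖ = 1) →
        ‖Φ‖ = 1 → RandomTensorNetwork.IsUnentangled Φ →
        ‖φ‖ = 1 → RandomTensorNetwork.IsUnentangled φ →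
        (RandomTensorNetwork.singleTensor a n).invEffDim ref Φ φ = 2 / ((a : ℝ) ^ n + 1) ∧
        (RandomTensorNetwork.singleTensor a n).effDim ref Φ φ = ((a : ℝ) ^ n + 1) / 2) := by
  constructor
  · intro V _ _ N ref Φ φ href hΦ hΦu hφ hφu
    have h := N.two_div_le_invEffDim ref Φ φ ha href hΦ hΦu hφ hφu
    refine ⟨h, ?_⟩
    rw [RandomTensorNetwork.Network.effDim, ← inv_div]
    exact inv_anti₀ (by positivity) h
  · intro ref Φ φ href hΦ hΦu hφ hφu
    have h := RandomTensorNetwork.invEffDim_singleTensor a n ha ref Φ φ href hΦ hΦu hφ hφu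
    exact ⟨h, by rw [RandomTensorNetwork.Network.effDim, h, inv_div]⟩
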